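/- A substitution of constant length $L\ge 2$ on a finite alphabet $A$ is a map $\theta:A\to A^L$, extended to finite words by juxtaposition; it is primitive if there is an $i$ such that every letter of $A$ occurs in $\theta^i(a)$ for every $a\in A$. For $\theta$ primitive, $X_\theta\subseteq A^{\mathbb Z}$ denotes the smallest closed shift-invariant set in which every word $\theta^i(a)$, $a\in A$, $i\ge 1$, appears, and $\sigma$ denotes the left shift, $(\sigma x)_i=x_{i+1}$; $(X_\theta,\sigma)$ is called the substitution minimal system generated by $\theta$. Two systems $(X,\sigma)$ and $(Y,\sigma)$ are topologically conjugate if there is a homeomorphism $\varphi:X\to Y$ with $\varphi\circ\sigma=\sigma\circ\varphi$. **Lemma.** Let $\theta$ and $\zeta$ be primitive substitutions of constant lengths $M\ge 2$ and $N\ge 2$ (on possibly different finite alphabets) such that $X_\theta$ and $X_\zeta$ are infinite and $(X_\theta,\sigma)$ and $(X_\zeta,\sigma)$ are topologically conjugate. If $M=RN$ for an integer $R>1$, then there is a primitive substitution $\xi$ of constant length $R$ on a finite alphabet such that $(X_\xi,\sigma)$ is topologically conjugate to both $(X_\theta,\sigma)$ and $(X_\zeta,\sigma)$. -/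

import Mathlib

/-!
Constant-length substitutions, the subshifts they generate, and topological conjugacy.
Two-sided subshifts are Mathlib's `SymbolicDynamics.FullShift.Subshift A ℤ` (closed subsets of
`ℤ → A` invariant under all powers of the shift), and the left shift is
`SymbolicDynamics.FullShift.shift 1`, i.e. `x ↦ (i ↦ x (1 + i))`.
-/

namespace ConstLength

open SymbolicDynamics.FullShift

/-- A constant-length substitution `θ : A → A^L`, extended to finite words by juxtaposition. -/
def substWord {A : Type*} {L : ℕ} (θ : A → Fin L → A) (w : List A) : List A :=
  w.flatMap fun a => List.ofFn (θ a)

/-- The word `θ^i(a)`. -/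
def iterWord {A : Type*} {L : ℕ} (θ : A → Fin L → A) (i : ℕ) (a : A) : List A :=
  (substWord θ)^[i] [a]

/-- `θ` is primitive: for some `i`, every letter occurs in every `θ^i(a)`. -/
def IsPrimitive {A : Type*} {L : ℕ} (θ : A → Fin L → A) : Prop :=
  ∃ i : ℕ, ∀ a b : A, b ∈ iterWord θ i a

/-- The finite word `w` appears in (some point of) `X`. -/
def WordAppears {A : Type*} (w : List A) (X : Set (ℤ → A)) : Prop :=
  ∃ x ∈ X, ∃ m : ℤ, ∀ (j : ℕ) (hj : j < w.length), x (m + j) = w[j]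

/-- Every word `θ^i(a)`, `a ∈ A`, `i ≥ 1`, appears in the subshift `X`. -/
def ContainsWords {A : Type*} [TopologicalSpace A] {L : ℕ} (θ : A → Fin L → A)
    (X : Subshift A ℤ) : Prop :=
  ∀ (i : ℕ) (a : A), 1 ≤ i → WordAppears (iterWord θ i a) X.carrier

/-- `X_θ`: the intersection of all subshifts in which every word `θ^i(a)`, `i ≥ 1`, appears.
For `θ` primitive of length at least `2` the words `θ^i(a)` appear in `X_θ` itself, so `X_θ` is
the smallest subshift with this property: see `substSystem_containsWords` and
`substSystem_subset`. -/
def substSystem {A : Type*} [TopologicalSpace A] {L : ℕ} (θ : A → Fin L → A) :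
    Subshift A ℤ where
  carrier := {x | ∀ X : Subshift A ℤ, ContainsWords θ X → x ∈ X.carrier}
  isClosed := by
    simp only [Set.ofPred_forall]
    exact isClosed_iInter fun X => isClosed_iInter fun _ => X.isClosed
  mapsTo := fun g _ hx X hX => X.mapsTo g (hx X hX)

/-- The left shift `(σ x)_i = x_{i+1}`, as a self-map of a subshift. -/
def shiftMap {A : Type*} [TopologicalSpace A] (X : Subshift A ℤ) : X.carrier → X.carrier :=
  (X.mapsTo 1).restrict

/-- `(X, σ)` and `(Y, σ)` are topologically conjugate. -/
def Conjugate {A B : Type*} [TopologicalSpace A] [TopologicalSpace B]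
    (X : Subshift A ℤ) (Y : Subshift B ℤ) : Prop :=
  ∃ φ : X.carrier ≃ₜ Y.carrier, ∀ x : X.carrier, φ (shiftMap X x) = shiftMap Y (φ x)

theorem substSystem_subset {A : Type*} [TopologicalSpace A] {L : ℕ} (θ : A → Fin L → A)
    (X : Subshift A ℤ) (hX : ContainsWords θ X) : (substSystem θ).carrier ⊆ X.carrier :=
  fun _ hx => hx X hX

theorem substWord_iterate_append {A : Type*} {L : ℕ} (θ : A → Fin L → A) (i : ℕ)
    (u v : List A) :
    (substWord θ)^[i] (u ++ v) = (substWord θ)^[i] u ++ (substWord θ)^[i] v := by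
  induction i generalizing u v with
  | zero => rfl
  | succ i ih =>
    simp only [Function.iterate_succ, Function.comp_apply]
    rw [← ih]
    simp [substWord]

theorem length_substWord_iterate {A : Type*} {L : ℕ} (θ : A → Fin L → A) (i : ℕ)
    (u : List A) : ((substWord θ)^[i] u).length = u.length * L ^ i := by
  induction i generalizing u with
  | zero => simp
  | succ i ih =>
    simp only [Function.iterate_succ, Function.comp_apply]
    rw [ih]
    simp [substWord, pow_succ]
    ring

/-- For `θ` primitive, every word `θ^i(a)` occurs in some `θ^k(c)` far away from both ends. -/
theorem exists_padded {A : Type*} {L : ℕ} (hL : 2 ≤ L) (θ : A → Fin L → A)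
    (hθ : IsPrimitive θ) (i : ℕ) (a : A) (n : ℕ) :
    ∃ (k : ℕ) (c : A) (u v : List A), 1 ≤ k ∧ iterWord θ k c = u ++ (iterWord θ i a ++ v) ∧
      n ≤ u.length ∧ n ≤ v.length := by
  obtain ⟨p, hp⟩ := hθ
  have hp' : ∀ (m : ℕ) (b : A), a ∈ iterWord θ (p + m) b := by
    intro m b
    have hlen := length_substWord_iterate θ m [b]
    have hpos : 0 < ((substWord θ)^[m] [b]).length := by
      rw [hlen]; simp; positivity
    obtain ⟨d, r, hdr⟩ := List.exists_cons_of_length_pos hpos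
    rw [iterWord, Function.iterate_add_apply, hdr, ← List.singleton_append,
      substWord_iterate_append]
    exact List.mem_append_left _ (hp d a)
  have hlen2 := length_substWord_iterate θ 2 [a]
  have h4 : 4 ≤ ((substWord θ)^[2] [a]).length := by
    rw [hlen2]; simp; nlinarith
  obtain ⟨c0, c1, c2, r, hr⟩ : ∃ c0 c1 c2 r, (substWord θ)^[2] [a] = [c0] ++ ([c1] ++ ([c2] ++ r)) := by
    rcases h : (substWord θ)^[2] [a] with _ | ⟨c0, _ | ⟨c1, _ | ⟨c2, r⟩⟩⟩
    · simp [h] at h4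
    · simp [h] at h4
    · simp [h] at h4
    · exact ⟨c0, c1, c2, r, rfl⟩
  obtain ⟨s, t, hst⟩ := List.append_of_mem (hp' n c1)
  set q := i + (p + n) with hq
  have hbig : n ≤ L ^ q := by
    calc n ≤ 2 ^ n := Nat.lt_two_pow_self.le
      _ ≤ L ^ n := Nat.pow_le_pow_left hL n
      _ ≤ L ^ q := Nat.pow_le_pow_right (by lia) (by lia)
  have hmid : (substWord θ)^[q] [c1]
      = (substWord θ)^[i] s ++ (iterWord θ i a ++ (substWord θ)^[i] t) := by
    rw [hq, Function.iterate_add_apply]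
    change (substWord θ)^[i] (iterWord θ (p + n) c1) = _
    rw [hst, ← List.singleton_append, substWord_iterate_append, substWord_iterate_append]
    rfl
  refine ⟨q + 2, a, (substWord θ)^[q] [c0] ++ (substWord θ)^[i] s,
    (substWord θ)^[i] t ++ ((substWord θ)^[q] [c2] ++ (substWord θ)^[q] r), by lia, ?_, ?_, ?_⟩
  · rw [iterWord, Function.iterate_add_apply, hr]
    simp only [substWord_iterate_append, hmid, List.append_assoc]
  · rw [List.length_append, length_substWord_iterate θ q]
    simp; lia
  · rw [List.length_append, List.length_append, length_substWord_iterate θ q [c2]]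
    simp; lia

/-- Well-definedness of `X_θ`: for `θ` primitive, the words `θ^i(a)` do appear in `X_θ`. -/
theorem substSystem_containsWords {A : Type*} [Finite A] [TopologicalSpace A]
    [DiscreteTopology A] {L : ℕ} (hL : 2 ≤ L) (θ : A → Fin L → A) (hθ : IsPrimitive θ) :
    ContainsWords θ (substSystem θ) := by
  intro i a _
  set w := iterWord θ i a with hw
  choose k c u v hk huv hu hv using exists_padded hL θ hθ i a
  -- in every admissible subshift, `u n ++ w ++ v n` appears with `w` starting at `0`
  have key : ∀ X : Subshift A ℤ, ContainsWords θ X → ∀ n : ℕ, ∃ x ∈ X.carrier,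
      ∀ (j : ℕ) (hj : j < (u n ++ (w ++ v n)).length),
        x ((j : ℤ) - (u n).length) = (u n ++ (w ++ v n))[j] := by
    intro X hX n
    obtain ⟨x, hx, m, hm⟩ := hX (k n) (c n) (hk n)
    refine ⟨shift (m + (u n).length) x, X.mapsTo _ hx, fun j hj => ?_⟩
    have := hm j (by rw [huv]; exact hj)
    simp only [huv] at this
    rw [← this, shift_apply]
    congr 1; ring
  have hfull : ContainsWords θ (fullShift A ℤ) := by
    intro i' a' _
    refine ⟨fun z => (iterWord θ i' a').getD z.toNat a', trivial, 0, fun j hj => ?_⟩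
    simp [hj]
  choose y hy1 hy2 using key _ hfull
  let U : Ultrafilter ℕ := Filter.hyperfilter ℕ
  obtain ⟨z, -, hz⟩ := isCompact_univ.ultrafilter_le_nhds (U.map y) (by simp)
  have hz' : Filter.Tendsto y U (nhds z) := hz
  have hU : ∀ n : ℕ, ∀ᶠ m in (U : Filter ℕ), n ≤ m := fun n =>
    (Nat.cofinite_eq_atTop ▸ Filter.hyperfilter_le_cofinite (α := ℕ))
      (Filter.eventually_ge_atTop n)
  refine ⟨z, ?_, 0, fun j hj => ?_⟩
  · intro X hX
    choose x hx1 hx2 using key X hX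
    refine X.isClosed.mem_of_tendsto (f := x) (b := (U : Filter ℕ)) ?_
      (Filter.Eventually.of_forall hx1)
    rw [tendsto_pi_nhds] at hz' ⊢
    intro l
    refine (hz' l).congr' ?_
    filter_upwards [hU (l.natAbs + 1)] with n hn
    have h1 := hu n
    have h2 := hv n
    obtain ⟨j, hj⟩ : ∃ j : ℕ, (j : ℤ) = l + (u n).length :=
      ⟨(l + (u n).length).toNat, by lia⟩
    have hjl : j < (u n ++ (w ++ v n)).length := by
      simp only [List.length_append]; lia
    have e1 := hx2 n j hjl
    have e2 := hy2 n j hjl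
    rw [← e1, show (j : ℤ) - (u n).length = l by lia] at e2
    exact e2
  · rw [tendsto_pi_nhds] at hz'
    have h0 := hz' j
    have : ∀ n, y n j = w[j] := by
      intro n
      have e := hy2 n ((u n).length + j) (by simp only [List.length_append]; lia)
      simp only [List.getElem_append_right (Nat.le_add_right _ _), Nat.add_sub_cancel_left,
        List.getElem_append_left hj] at e
      rw [← e]
      congr 1; push_cast; ring
    simp only [this] at h0
    rw [zero_add]
    exact tendsto_nhds_unique h0 tendsto_const_nhds

end ConstLength

/-! Write X, Y for the two systems and let θ, ζ act on two-sided sequences, so that θσ = σ^M θ on X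
and ζσ = σ^N ζ on Y. The proof divides θ by ζ. For a conjugacy φ : X → Y, the map f = φθ satisfies
fσ = σ^(RN) f. The translates σ^j ζ(Y), 0 ≤ j < N, are closed, σ^N-invariant and cover Y, so
minimality of X confines f(X) to one of them (`exists_shift_lift`). Since ζ is injective on Y, g =
(σ^j ζ)⁻¹ f φ⁻¹ is a continuous self-map of Y with gσ = σ^R g.

Such a g already produces ξ (`exists_substSystem_of_map`): recode y by a wide enough central window.
As g expands by R ≥ 2, that window of y determines the corresponding windows of g y at 0, …, R - 1,
which is a substitution rule of length R.

The substantial point is injectivity (`IsBlockSubst.injOn`), which rests on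
`IsBlockSubst.phase_unique`. If two of the P translates of ψ(X) met, they would coincide, and (P -
1)^k translates of ψ^k(X) would cover X. Each of the P^k shifts of ψ^k(x) is then described by one
of these translates and a radius-1 local rule; the number of rules does not depend on k, so for
large k two shifts agree, and a periodic point makes X finite. -/

namespace ConstLength

open SymbolicDynamics.FullShift

/-! ### Block substitutions: composition, iteration, continuity -/

/-- A self-map of `ℤ → A` that replaces the letter at each position `i` by a word of length `P`,
depending only on that letter, placed at the positions `P * i, …, P * i + P - 1`. -/
structure IsBlockSubst {A : Type*} (P : ℕ) (ψ : (ℤ → A) → ℤ → A) : Prop where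
  map_shift : ∀ (n : ℤ) (x : ℤ → A), ψ (shift n x) = shift (P * n) (ψ x)
  eq_of_zero : ∀ x y : ℤ → A, x 0 = y 0 → ∀ j : ℤ, 0 ≤ j → j < P → ψ x j = ψ y j

namespace IsBlockSubst

variable {A : Type*} {P Q : ℕ} {ψ χ : (ℤ → A) → ℤ → A}

theorem eq_of_eq (h : IsBlockSubst P ψ) {x y : ℤ → A} {i i' : ℤ} (hxy : x i = y i') {j : ℤ}
    (h0 : 0 ≤ j) (hj : j < P) : ψ x (P * i + j) = ψ y (P * i' + j) := by
  have := h.eq_of_zero (shift i x) (shift i' y) (by simpa [shift_apply] using hxy) j h0 hj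
  simpa only [h.map_shift, shift_apply] using this

theorem id_one : IsBlockSubst 1 (id : (ℤ → A) → ℤ → A) where
  map_shift n x := by simp
  eq_of_zero x y hxy j h0 hj := by
    obtain rfl : j = 0 := by push_cast at hj; lia
    exact hxy

theorem comp (h : IsBlockSubst P ψ) (h' : IsBlockSubst Q χ) :
    IsBlockSubst (Q * P) (ψ ∘ χ) where
  map_shift n x := by
    simp only [Function.comp_apply, h'.map_shift, h.map_shift]
    congr 1
    push_cast
    ring
  eq_of_zero x y hxy j h0 hj := by
    have hP : (0 : ℤ) < P := by
      rcases Nat.eq_zero_or_pos P with rfl | hP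
      · simp at hj; lia
      · exact_mod_cast hP
    have e : j = P * (j / P) + j % P := (Int.mul_ediv_add_emod j P).symm
    rw [e]
    refine h.eq_of_eq ?_ (Int.emod_nonneg _ hP.ne') (Int.emod_lt_of_pos _ hP)
    refine h'.eq_of_zero x y hxy _ (Int.ediv_nonneg h0 hP.le) ?_
    exact Int.ediv_lt_of_lt_mul hP (by push_cast at hj; exact hj)

theorem iterate (h : IsBlockSubst P ψ) (k : ℕ) : IsBlockSubst (P ^ k) (ψ^[k]) := by
  induction k with
  | zero => simpa using id_one
  | succ k ih =>
    rw [Function.iterate_succ, pow_succ, mul_comm]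
    exact ih.comp h

theorem continuous [TopologicalSpace A] [DiscreteTopology A] (h : IsBlockSubst P ψ)
    (hP : 0 < P) : Continuous ψ := by
  have hP' : (0 : ℤ) < P := by exact_mod_cast hP
  refine continuous_pi fun i => ?_
  have : (fun x => ψ x i) = (fun a => ψ (fun _ => a) i) ∘ fun x : ℤ → A => x (i / P) := by
    funext x
    have := h.eq_of_eq (x := x) (y := fun _ => x (i / P)) (i := i / P) (i' := i / P) rfl
      (Int.emod_nonneg i hP'.ne') (Int.emod_lt_of_pos i hP')
    rwa [Int.mul_ediv_add_emod] at this
  rw [this]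
  exact continuous_of_discreteTopology.comp (continuous_apply _)

end IsBlockSubst

/-! ### Words θ^k(a) as blocks of the sequence map -/

theorem length_iterWord {A : Type*} {L : ℕ} (θ : A → Fin L → A) (k : ℕ) (a : A) :
    (iterWord θ k a).length = L ^ k := by
  simp [iterWord, length_substWord_iterate]

/-- The action of a substitution on two-sided sequences. -/
def substMap {A : Type*} {L : ℕ} [NeZero L] (θ : A → Fin L → A) (x : ℤ → A) : ℤ → A :=
  fun i => θ (x (i / L)) (Fin.ofNat L (i % L).toNat)

section Words

variable {A : Type*} {L : ℕ} [NeZero L] (θ : A → Fin L → A)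

theorem isBlockSubst_substMap : IsBlockSubst L (substMap θ) where
  map_shift n x := by
    have hL : (L : ℤ) ≠ 0 := by exact_mod_cast NeZero.ne L
    funext i
    simp only [substMap, shift_apply, Int.mul_add_emod_self_left, Int.add_ediv_of_dvd_left
      (Dvd.intro n rfl : (L : ℤ) ∣ L * n), Int.mul_ediv_cancel_left _ hL]
  eq_of_zero x y hxy j h0 hj := by
    simp only [substMap, Int.ediv_eq_zero_of_lt h0 hj, hxy]

theorem substMap_mul_add (x : ℤ → A) (m : ℤ) (j : Fin L) :
    substMap θ x (L * m + (j : ℕ)) = θ (x m) j := by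
  have hL : (L : ℤ) ≠ 0 := by exact_mod_cast NeZero.ne L
  have h1 : ((j : ℕ) : ℤ) < L := by exact_mod_cast j.2
  have h2 : (0 : ℤ) ≤ ((j : ℕ) : ℤ) := by positivity
  simp only [substMap, Int.mul_add_emod_self_left, Int.add_ediv_of_dvd_left
      (Dvd.intro m rfl : (L : ℤ) ∣ L * m), Int.mul_ediv_cancel_left _ hL,
      Int.ediv_eq_zero_of_lt h2 h1, Int.emod_eq_of_lt h2 h1, add_zero]
  congr 1
  ext
  simp

theorem substMap_match (w : List A) (x : ℤ → A) (m : ℤ)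
    (h : ∀ (j : ℕ) (hj : j < w.length), x (m + j) = w[j]) :
    ∀ (j : ℕ) (hj : j < (substWord θ w).length),
      substMap θ x (L * m + j) = (substWord θ w)[j] := by
  induction w generalizing m with
  | nil => intro j hj; simp [substWord] at hj
  | cons a w ih =>
    intro j hj
    have e : substWord θ (a :: w) = List.ofFn (θ a) ++ substWord θ w := by simp [substWord]
    simp only [e]
    have h0 : x m = a := by have := h 0 (by simp); rwa [Nat.cast_zero, add_zero] at this
    rcases lt_or_ge j L with hjL | hjL
    · rw [List.getElem_append_left (by simpa using hjL), List.getElem_ofFn]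
      rw [← h0]
      exact substMap_mul_add θ x m ⟨j, hjL⟩
    · have hj' : j - L < (substWord θ w).length := by
        rw [e, List.length_append, List.length_ofFn] at hj
        lia
      rw [List.getElem_append_right (by simpa using hjL)]
      have := ih (m + 1) (fun i hi => by
        have := h (i + 1) (by simpa using hi)
        rw [List.getElem_cons_succ] at this
        rw [← this]; congr 1; push_cast; ring) (j - L) hj'
      simp only [List.length_ofFn]
      rw [← this]
      congr 1
      push_cast [Nat.cast_sub hjL]
      ring

theorem iterate_substMap_match (k : ℕ) (a : A) (j : ℕ) (hj : j < (iterWord θ k a).length) :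
    (substMap θ)^[k] (fun _ => a) j = (iterWord θ k a)[j] := by
  have key : ∀ (k j : ℕ) (hj : j < ((substWord θ)^[k] [a]).length),
      (substMap θ)^[k] (fun _ => a) (0 + j) = ((substWord θ)^[k] [a])[j] := by
    intro k
    induction k with
    | zero => intro j hj; simp
    | succ k ih =>
      intro j hj
      have := substMap_match θ ((substWord θ)^[k] [a]) ((substMap θ)^[k] fun _ => a) 0 ih j
        (by simpa only [Function.iterate_succ_apply'] using hj)
      simpa only [Function.iterate_succ_apply', mul_zero] using this
  have := key k j hj
  rwa [zero_add] at this

theorem wordAppears_iterWord_iff (k : ℕ) (a : A) (X : Set (ℤ → A)) :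
    WordAppears (iterWord θ k a) X ↔ ∃ x ∈ X, ∃ m : ℤ, ∀ j : ℤ, 0 ≤ j → j < ((L ^ k : ℕ) : ℤ) →
      x (m + j) = (substMap θ)^[k] (fun _ => a) j := by
  refine exists_congr fun x => and_congr_right fun _ => exists_congr fun m => ⟨fun h j h0 hj => ?_,
    fun h j hj => ?_⟩
  · lift j to ℕ using h0
    have hj' : j < (iterWord θ k a).length := by rw [length_iterWord]; exact_mod_cast hj
    rw [h j hj', iterate_substMap_match θ k a j hj']
  · rw [h j (by positivity) (by rw [length_iterWord] at hj; exact_mod_cast hj),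
      iterate_substMap_match θ k a j hj]

theorem mem_iterWord_iff (k : ℕ) (a b : A) :
    b ∈ iterWord θ k a ↔
      ∃ j : ℤ, 0 ≤ j ∧ j < ((L ^ k : ℕ) : ℤ) ∧ (substMap θ)^[k] (fun _ => a) j = b := by
  rw [List.mem_iff_getElem]
  constructor
  · rintro ⟨j, hj, rfl⟩
    refine ⟨j, by positivity, ?_, iterate_substMap_match θ k a j hj⟩
    rw [length_iterWord] at hj
    exact_mod_cast hj
  · rintro ⟨j, h0, hj, rfl⟩
    lift j to ℕ using h0
    have hj' : j < (iterWord θ k a).length := by rw [length_iterWord]; exact_mod_cast hj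
    exact ⟨j, hj', (iterate_substMap_match θ k a j hj').symm⟩

end Words

/-! ### The language of a primitive substitution and minimality -/

/-- A nonempty subshift without proper nonempty closed shift-invariant subsets. -/
def IsMinimalSubshift {A : Type*} [TopologicalSpace A] (X : Subshift A ℤ) : Prop :=
  X.carrier.Nonempty ∧ ∀ C : Set (ℤ → A), IsClosed C → C ⊆ X.carrier → C.Nonempty →
    (∀ (n : ℤ), ∀ x ∈ C, shift n x ∈ C) → X.carrier ⊆ C

theorem isClopen_of_window {A : Type*} [TopologicalSpace A] [DiscreteTopology A]
    (n : ℕ) (K : Set (ℤ → A))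
    (h : ∀ x y : ℤ → A, (∀ i : ℤ, -n ≤ i → i ≤ n → x i = y i) → x ∈ K → y ∈ K) :
    IsClopen K := by
  let r : (ℤ → A) → (Set.Icc (-n : ℤ) n → A) := fun x i => x i
  have hr : Continuous r := continuous_pi fun i => continuous_apply _
  have e : K = r ⁻¹' (r '' K) := by
    refine Set.Subset.antisymm (Set.subset_preimage_image r K) ?_
    rintro y ⟨x, hx, hxy⟩
    exact h x y (fun i h1 h2 => congrFun hxy ⟨i, h1, h2⟩) hx
  rw [e]
  exact (isClopen_discrete _).preimage hr

theorem exists_window_of_isOpen {A : Type*} [TopologicalSpace A] [DiscreteTopology A]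
    {U : Set (ℤ → A)} (hU : IsOpen U) {x : ℤ → A} (hx : x ∈ U) :
    ∃ n : ℕ, ∀ y : ℤ → A, (∀ i : ℤ, -n ≤ i → i ≤ n → y i = x i) → y ∈ U := by
  obtain ⟨I, u, hI, hIU⟩ := isOpen_pi_iff.1 hU x hx
  refine ⟨I.sup Int.natAbs, fun y hy => hIU fun i hi => ?_⟩
  have : i.natAbs ≤ I.sup Int.natAbs := Finset.le_sup (f := Int.natAbs) hi
  rw [hy i (by lia) (by lia)]
  exact (hI i hi).2

section Language

variable {A : Type*} {L : ℕ} [NeZero L] (θ : A → Fin L → A)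

/-- The central word of radius `n` of `x` occurs in some word `θ^k(c)`, `k ≥ 1`. -/
def WindowOccurs (n : ℕ) (x : ℤ → A) : Prop :=
  ∃ (k : ℕ) (c : A) (m : ℤ), 1 ≤ k ∧ n ≤ m ∧ m + n < ((L ^ k : ℕ) : ℤ) ∧
    ∀ i : ℤ, -n ≤ i → i ≤ n → x i = (substMap θ)^[k] (fun _ => c) (m + i)

variable {θ}

theorem WindowOccurs.of_shift {n : ℕ} {x : ℤ → A} (t : ℤ)
    (h : WindowOccurs θ (n + t.natAbs) x) : WindowOccurs θ n (shift t x) := by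
  obtain ⟨k, c, m, hk, h1, h2, h3⟩ := h
  refine ⟨k, c, m + t, hk, by lia, by lia, fun i hi hi' => ?_⟩
  rw [shift_apply, h3 (t + i) (by lia) (by lia), add_assoc]

theorem WindowOccurs.mono {n n' : ℕ} (hn : n ≤ n') {x : ℤ → A}
    (h : WindowOccurs θ n' x) : WindowOccurs θ n x := by
  obtain ⟨k, c, m, hk, h1, h2, h3⟩ := h
  exact ⟨k, c, m, hk, by lia, by lia, fun i hi hi' => h3 i (by lia) (by lia)⟩

/-- The centre m moves to L * m, and position i of the image comes from position ⌊i / L⌋, which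
still lies in [-n, n]; hence no radius is lost. -/
theorem WindowOccurs.substMap {n : ℕ} {x : ℤ → A}
    (h : WindowOccurs θ n x) : WindowOccurs θ n (substMap θ x) := by
  obtain ⟨k, c, m, hk, h1, h2, h3⟩ := h
  have hL : (1 : ℤ) ≤ L := by exact_mod_cast NeZero.one_le
  refine ⟨k + 1, c, L * m, by lia, by nlinarith, ?_, fun i hi hi' => ?_⟩
  · rw [pow_succ]
    push_cast at h2 ⊢
    nlinarith
  · rw [Function.iterate_succ_apply']
    have e := Int.mul_ediv_add_emod i L
    have r0 := Int.emod_nonneg i (by lia : (L : ℤ) ≠ 0)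
    have r1 := Int.emod_lt_of_pos i (by lia : (0 : ℤ) < L)
    have q0 : -(n : ℤ) ≤ i / L := by
      rw [Int.le_ediv_iff_mul_le (by lia)]
      nlinarith
    have q1 : i / L ≤ n := by
      rcases le_or_gt 0 i with h | h
      · exact (Int.ediv_le_self _ h).trans hi'
      · exact (Int.ediv_neg_of_neg_of_pos h (by lia)).le.trans (by positivity)
    have := (isBlockSubst_substMap θ).eq_of_eq (h3 (i / L) q0 q1) r0 r1
    rw [e] at this
    rw [this]
    congr 1
    linear_combination e

/-- Every word `θ^i(a)` occurs in every sequence all of whose windows occur in the words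
`θ^k(c)`. -/
theorem exists_occurrence (hL : 2 ≤ L) (hθ : IsPrimitive θ) {x : ℤ → A}
    (hx : ∀ n, WindowOccurs θ n x) (i : ℕ) (a : A) :
    ∃ m : ℤ, ∀ j : ℤ, 0 ≤ j → j < ((L ^ i : ℕ) : ℤ) →
      x (m + j) = (substMap θ)^[i] (fun _ => a) j := by
  obtain ⟨p, hp⟩ := hθ
  -- With n = L^(i+p), a window of radius n contains a full aligned block [n * t, n * t + n), t = ⌊m
  -- / n⌋. That block is θ^(i+p) of one letter, so primitivity with exponent p finds θ^i(a) in it.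
  obtain ⟨k, c, m, hk, h1, h2, h3⟩ := hx (L ^ (i + p))
  have hb := isBlockSubst_substMap θ
  set n : ℕ := L ^ (i + p) with hn
  have hn0 : (0 : ℤ) < n := by positivity
  have hqk : i + p < k := by
    have : L ^ (i + p) < L ^ k := by rw [← hn]; lia
    exact (Nat.pow_lt_pow_iff_right (by lia)).1 this
  obtain ⟨r, rfl⟩ := Nat.exists_eq_add_of_le hqk.le
  have hmod := Int.mul_ediv_add_emod m n
  have r0 := Int.emod_nonneg m hn0.ne'
  have r1 := Int.emod_lt_of_pos m hn0
  set t := m / n with ht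
  obtain ⟨l, l0, l1, hl⟩ := (mem_iterWord_iff θ p ((substMap θ)^[r] (fun _ => c) t) a).1 (hp _ _)
  have hni : (n : ℤ) = ((L ^ i : ℕ) : ℤ) * ((L ^ p : ℕ) : ℤ) := by
    rw [hn, pow_add]; push_cast; rfl
  refine ⟨n * t + (L ^ i : ℕ) * l - m, fun j j0 j1 => ?_⟩
  have b0 : 0 ≤ ((L ^ i : ℕ) : ℤ) * l + j := by positivity
  have b1 : ((L ^ i : ℕ) : ℤ) * l + j < n := by
    rw [hni]
    nlinarith
  rw [h3 _ (by lia) (by lia)]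
  have e1 := (hb.iterate (i + p)).eq_of_eq (x := (substMap θ)^[r] (fun _ => c))
    (y := fun _ => (substMap θ)^[r] (fun _ => c) t) (i := t) (i' := 0) rfl b0 b1
  rw [← Function.iterate_add_apply, Function.iterate_add_apply _ i p, mul_zero, zero_add] at e1
  have e2 := (hb.iterate i).eq_of_eq (i := l) (i' := 0) (y := fun _ => a) hl j0 j1
  rw [mul_zero, zero_add] at e2
  rw [← e2, ← e1]
  refine congrArg _ ?_
  rw [← hn]
  ring

variable (θ) [TopologicalSpace A] [DiscreteTopology A]

theorem isClopen_windowOccurs (n : ℕ) : IsClopen {x | WindowOccurs θ n x} := by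
  refine isClopen_of_window n _ ?_
  rintro x y hxy ⟨k, c, m, hk, h1, h2, h3⟩
  exact ⟨k, c, m, hk, h1, h2, fun i hi hi' => (hxy i hi hi').symm.trans (h3 i hi hi')⟩

/-- The sequences all of whose windows occur in the words `θ^k(c)`, as a subshift. -/
def languageShift : Subshift A ℤ where
  carrier := {x | ∀ n, WindowOccurs θ n x}
  isClosed := by
    simp only [Set.ofPred_forall]
    exact isClosed_iInter fun n => (isClopen_windowOccurs θ n).1
  mapsTo := fun t _ hx n => (hx (n + t.natAbs)).of_shift t

variable {θ}

/-- By `exists_occurrence` a single point of C contains all words θ^i(a), so C is one of the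
subshifts intersected in X_θ. Minimality follows from this. -/
theorem substSystem_subset_of_invariant (hL : 2 ≤ L) (hθ : IsPrimitive θ) {C : Set (ℤ → A)}
    (hC : IsClosed C) (hCs : C ⊆ (languageShift θ).carrier) (hne : C.Nonempty)
    (hinv : ∀ (n : ℤ), ∀ x ∈ C, shift n x ∈ C) : (substSystem θ).carrier ⊆ C := by
  refine substSystem_subset θ ⟨C, hC, fun n x hx => hinv n x hx⟩ fun i a _ => ?_
  obtain ⟨x, hx⟩ := hne
  rw [wordAppears_iterWord_iff]
  exact ⟨x, hx, exists_occurrence hL hθ (hCs hx) i a⟩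

/-- A point outside the closed set X is excluded by a finite window, yet that window sits in some
θ^k(c), which appears in X. -/
theorem languageShift_subset (X : Subshift A ℤ) (hX : ContainsWords θ X) :
    (languageShift θ).carrier ⊆ X.carrier := by
  intro x hx
  by_contra hxX
  obtain ⟨n, hn⟩ := exists_window_of_isOpen X.isClosed.isOpen_compl hxX
  obtain ⟨k, c, m, hk, h1, h2, h3⟩ := hx n
  obtain ⟨y, hy, m', hm'⟩ := (wordAppears_iterWord_iff θ k c _).1 (hX k c hk)
  refine hn (shift (m' + m) y) (fun i hi hi' => ?_) (X.mapsTo _ hy)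
  rw [h3 i hi hi', ← hm' (m + i) (by lia) (by lia), shift_apply, add_assoc]

variable [Finite A]

theorem languageShift_nonempty [Nonempty A] (hL : 2 ≤ L) :
    (languageShift θ).carrier.Nonempty := by
  have e : (languageShift θ).carrier = ⋂ n, {x | WindowOccurs θ n x} := by
    ext x; simp [languageShift]
  rw [e]
  refine IsCompact.nonempty_iInter_of_sequence_nonempty_isCompact_isClosed _ ?_ ?_ ?_ ?_
  · intro n x hx
    exact WindowOccurs.mono (Nat.le_succ n) hx
  · intro n
    obtain ⟨c⟩ := ‹Nonempty A›
    -- A word of length exceeding 2n + 1 has room for a window of radius n centred at n.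
    have hk : 2 * n + 1 < L ^ (2 * n + 1) := Nat.lt_pow_self (by lia)
    refine ⟨shift n ((substMap θ)^[2 * n + 1] fun _ => c), 2 * n + 1, c, n, by lia, le_rfl,
      ?_, fun i _ _ => by rw [shift_apply]⟩
    zify at hk
    push_cast
    lia
  · exact (isClopen_windowOccurs θ 0).1.isCompact
  · exact fun n => (isClopen_windowOccurs θ n).1

theorem substSystem_carrier_eq [Nonempty A] (hL : 2 ≤ L) (hθ : IsPrimitive θ) :
    (substSystem θ).carrier = (languageShift θ).carrier := by
  refine Set.Subset.antisymm ?_ fun x hx X hX => languageShift_subset X hX hx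
  exact substSystem_subset_of_invariant hL hθ (languageShift θ).isClosed subset_rfl
    (languageShift_nonempty hL) fun n x hx => (languageShift θ).mapsTo n hx

theorem isMinimalSubshift_substSystem [Nonempty A] (hL : 2 ≤ L) (hθ : IsPrimitive θ) :
    IsMinimalSubshift (substSystem θ) := by
  have e := substSystem_carrier_eq hL hθ
  refine ⟨e ▸ languageShift_nonempty hL, fun C hC hCs hne hinv => ?_⟩
  exact substSystem_subset_of_invariant hL hθ hC (e ▸ hCs) hne hinv

theorem mapsTo_substMap [Nonempty A] (hL : 2 ≤ L) (hθ : IsPrimitive θ) :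
    Set.MapsTo (substMap θ) (substSystem θ).carrier (substSystem θ).carrier := by
  rw [substSystem_carrier_eq hL hθ]
  exact fun x hx n => (hx n).substMap

end Language

/-! ### Recognizability: unique phases and injectivity -/

/-- The orbit of z is finite, hence closed, and minimality makes it all of X. -/
theorem IsMinimalSubshift.finite_of_periodic {A : Type*} [TopologicalSpace A]
    [T1Space A] {X : Subshift A ℤ} (hX : IsMinimalSubshift X) {z : ℤ → A}
    (hz : z ∈ X.carrier) {q : ℤ} (hq : 0 < q) (hper : shift q z = z) : X.carrier.Finite := by
  have hp : Function.Periodic (fun n : ℤ => shift n z) q := by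
    intro n
    change shift (n + q) z = shift n z
    rw [add_comm, shift_add, hper]
  have hfin : (Set.range fun n : ℤ => shift n z).Finite := by
    refine ((Set.finite_Ico (0 : ℤ) q).image fun n => shift n z).subset ?_
    rintro _ ⟨n, rfl⟩
    refine ⟨n % q, ⟨Int.emod_nonneg _ hq.ne', Int.emod_lt_of_pos _ hq⟩, ?_⟩
    have := hp.int_mul (n / q) (n % q)
    rwa [mul_comm, Int.cast_id, Int.emod_add_mul_ediv, eq_comm] at this
  refine hfin.subset (hX.2 _ hfin.isClosed ?_ ⟨_, 0, rfl⟩ ?_)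
  · rintro _ ⟨n, rfl⟩
    exact X.mapsTo n hz
  · rintro n _ ⟨m, rfl⟩
    exact ⟨m + n, shift_add m n z⟩

theorem exists_mul_pow_lt_pow (F Q : ℕ) : ∃ k : ℕ, F * Q ^ k < (Q + 1) ^ k := by
  have h1 : (Q : ℝ) / (Q + 1) < 1 := by rw [div_lt_one (by positivity)]; linarith
  obtain ⟨k, hk⟩ := exists_pow_lt_of_lt_one (show (0 : ℝ) < 1 / (F + 1) by positivity) h1
  refine ⟨k, ?_⟩
  rw [div_pow, div_lt_div_iff₀ (by positivity) (by positivity)] at hk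
  have h2 : (0 : ℝ) ≤ (Q : ℝ) ^ k := by positivity
  have : ((F * Q ^ k : ℕ) : ℝ) < (((Q + 1) ^ k : ℕ) : ℝ) := by push_cast; nlinarith
  exact_mod_cast this

namespace IsBlockSubst

section

variable {A : Type*} {Q : ℕ} {χ : (ℤ → A) → ℤ → A}

/-- Constant sequences record the blocks of single letters, so the kernel of χ becomes a relation on
the finite alphabet. -/
theorem apply_eq_iff (h : IsBlockSubst Q χ) (hQ : 0 < Q) (x y : ℤ → A) :
    χ x = χ y ↔ ∀ i, χ (fun _ => x i) = χ (fun _ => y i) := by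
  have hQ' : (0 : ℤ) < Q := by exact_mod_cast hQ
  constructor <;> intro H
  · intro i
    funext n
    have r0 := Int.emod_nonneg n hQ'.ne'
    have r1 := Int.emod_lt_of_pos n hQ'
    rw [← Int.mul_ediv_add_emod n Q,
      h.eq_of_eq (x := fun _ => x i) (y := x) (i' := i) rfl r0 r1,
      h.eq_of_eq (x := fun _ => y i) (y := y) (i' := i) rfl r0 r1, H]
  · funext n
    have r0 := Int.emod_nonneg n hQ'.ne'
    have r1 := Int.emod_lt_of_pos n hQ'
    rw [← Int.mul_ediv_add_emod n Q,
      h.eq_of_eq (y := fun _ => x (n / Q)) (i' := 0) rfl r0 r1,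
      h.eq_of_eq (x := y) (y := fun _ => y (n / Q)) (i' := 0) rfl r0 r1, H]

/-- If `χ y` is a translate of `χ x` by less than one block, then `y` can be replaced by the image
of `x` under a sliding block code of radius `1`. -/
theorem exists_local_rule (h : IsBlockSubst Q χ) {x y : ℤ → A} {d : ℤ} (hd : -Q < d)
    (hd' : d < Q) (hxy : χ y = shift d (χ x)) :
    ∃ f : A × A × A → A, χ (fun i => f (x (i - 1), x i, x (i + 1))) = χ y := by
  have hQ : (0 : ℤ) < Q := by lia
  let T : ℤ → A × A × A := fun i => (x (i - 1), x i, x (i + 1))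
  have hT : ∀ i, T (Function.invFun T (T i)) = T i := fun i => Function.invFun_eq ⟨i, rfl⟩
  -- The rule samples y at one chosen position carrying the triple t; triples that never occur get
  -- an irrelevant value.
  refine ⟨fun t => y (Function.invFun T t), ?_⟩
  funext n
  have r0 := Int.emod_nonneg n hQ.ne'
  have r1 := Int.emod_lt_of_pos n hQ
  have hn := Int.mul_ediv_add_emod n Q
  set i := n / Q
  set r := n % Q
  set i' := Function.invFun T (T i) with hi'
  rw [← hn, h.eq_of_eq (x := fun i => y (Function.invFun T (T i))) (y := y) (i := i) (i' := i')
    rfl r0 r1, hxy, shift_apply, shift_apply]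
  have s0 := Int.emod_nonneg (d + r) hQ.ne'
  have s1 := Int.emod_lt_of_pos (d + r) hQ
  have hs := Int.mul_ediv_add_emod (d + r) Q
  set e := (d + r) / Q
  set s := (d + r) % Q
  -- Since |d| < Q, block i of χ y meets only blocks i - 1, i, i + 1 of χ x.
  have e0 : -1 ≤ e := by by_contra! hlt; nlinarith
  have e1 : e ≤ 1 := by by_contra! hlt; nlinarith
  have hx : x (i' + e) = x (i + e) := by
    have := hT i
    simp only [← hi', T, Prod.mk.injEq] at this
    obtain ⟨t1, t2, t3⟩ := this
    obtain h | h | h : e = -1 ∨ e = 0 ∨ e = 1 := by lia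
    · simpa only [h, ← sub_eq_add_neg] using t1
    · simpa only [h, add_zero] using t2
    · simpa only [h] using t3
  have := h.eq_of_eq hx s0 s1
  rw [show d + (Q * i' + r) = Q * (i' + e) + s by linear_combination -hs,
    show d + (Q * i + r) = Q * (i + e) + s by linear_combination -hs, this]

end

variable {A : Type*} [TopologicalSpace A] {X : Subshift A ℤ} {P : ℕ} {ψ : (ℤ → A) → ℤ → A}

/-- Offsets compose like base-P digits, σ^i ψ σ^t ψ^k = σ^(P t + i) ψ^(k+1), so a digit missing from
I is missing at every level. -/
theorem exists_iterate_cover (h : IsBlockSubst P ψ) {I : Finset ℤ} (hI : I ⊆ Finset.Ico 0 (P : ℤ))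
    (hcov : ∀ x ∈ X.carrier, ∃ j ∈ I, ∃ y ∈ X.carrier, shift j (ψ y) = x) (k : ℕ) :
    ∃ J : Finset ℤ, J.card ≤ I.card ^ k ∧ J ⊆ Finset.Ico 0 ((P ^ k : ℕ) : ℤ) ∧
      ∀ x ∈ X.carrier, ∃ j ∈ J, ∃ y ∈ X.carrier, shift j (ψ^[k] y) = x := by
  induction k with
  | zero => exact ⟨{0}, by simp, by simp, fun x hx => ⟨0, by simp, x, hx, by simp⟩⟩
  | succ k ih =>
    obtain ⟨J, hJc, hJ, hJcov⟩ := ih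
    refine ⟨Finset.image₂ (fun i t => P * t + i) I J, ?_, ?_, ?_⟩
    · calc _ ≤ I.card * J.card := Finset.card_image₂_le _ _ _
        _ ≤ I.card * I.card ^ k := Nat.mul_le_mul_left _ hJc
        _ = _ := by ring
    · intro n hn
      obtain ⟨i, hi, t, ht, rfl⟩ := Finset.mem_image₂.1 hn
      have hi := Finset.mem_Ico.1 (hI hi)
      have ht := Finset.mem_Ico.1 (hJ ht)
      rw [Finset.mem_Ico, pow_succ]
      push_cast at ht ⊢
      constructor <;> nlinarith
    · intro x hx
      obtain ⟨i, hi, y, hy, rfl⟩ := hcov x hx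
      obtain ⟨t, ht, z, hz, rfl⟩ := hJcov y hy
      refine ⟨P * t + i, Finset.mem_image₂_of_mem hi ht, z, hz, ?_⟩
      rw [h.map_shift, ← shift_add, Function.iterate_succ_apply']

variable [Finite A] [DiscreteTopology A]

theorem isClosed_image (h : IsBlockSubst P ψ) (hP : 0 < P) (j : ℤ) :
    IsClosed ((fun y => shift j (ψ y)) '' X.carrier) :=
  (X.isClosed.isCompact.image ((continuous_shift j).comp (h.continuous hP))).isClosed

/-- The translates of the image of a minimal subshift under a block substitution cover it. -/
theorem exists_eq_shift (h : IsBlockSubst P ψ) (hP : 0 < P) (hX : IsMinimalSubshift X)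
    (hm : Set.MapsTo ψ X.carrier X.carrier) {x : ℤ → A} (hx : x ∈ X.carrier) :
    ∃ j ∈ Finset.Ico (0 : ℤ) P, ∃ y ∈ X.carrier, shift j (ψ y) = x := by
  have hP' : (0 : ℤ) < P := by exact_mod_cast hP
  have := hX.2 (⋃ j ∈ Finset.Ico (0 : ℤ) P, (fun y => shift j (ψ y)) '' X.carrier)
    (isClosed_biUnion_finset fun j _ => h.isClosed_image hP j) ?_ ?_ ?_ hx
  · simpa only [Set.mem_iUnion, Set.mem_image, exists_prop] using this
  · simp only [Set.iUnion_subset_iff]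
    rintro j _ _ ⟨y, hy, rfl⟩
    exact X.mapsTo j (hm hy)
  · obtain ⟨y, hy⟩ := hX.1
    refine ⟨shift 0 (ψ y), ?_⟩
    simp only [Set.mem_iUnion, Set.mem_image]
    exact ⟨0, by simpa using hP, y, hy, rfl⟩
  · intro n z hz
    simp only [Set.mem_iUnion, Set.mem_image] at hz ⊢
    obtain ⟨j, _, y, hy, rfl⟩ := hz
    -- Only the residue of the offset mod P matters; the quotient is absorbed into y.
    refine ⟨(j + n) % P, Finset.mem_Ico.2
      ⟨Int.emod_nonneg _ hP'.ne', Int.emod_lt_of_pos _ hP'⟩,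
      shift ((j + n) / P) y, X.mapsTo _ hy, ?_⟩
    rw [h.map_shift, ← shift_add, ← shift_add, Int.mul_ediv_add_emod]

/-- Two translates of the image of a minimal subshift under a block substitution coincide as soon
as they meet. -/
theorem exists_of_shift_eq (h : IsBlockSubst P ψ) (hP : 0 < P) (hX : IsMinimalSubshift X)
    {j j' : ℤ} {x y : ℤ → A} (hx : x ∈ X.carrier) (hy : y ∈ X.carrier)
    (hxy : shift j (ψ x) = shift j' (ψ y)) {z : ℤ → A} (hz : z ∈ X.carrier) :
    ∃ z' ∈ X.carrier, shift j (ψ z') = shift j' (ψ z) := by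
  have hc : Continuous fun y => shift j' (ψ y) := (continuous_shift j').comp (h.continuous hP)
  -- The points z for which σ^j' ψ(z) lies in σ^j ψ(X) form a closed invariant set, nonempty by
  -- `hxy`.
  refine (hX.2 (X.carrier ∩ (fun y => shift j' (ψ y)) ⁻¹' ((fun y => shift j (ψ y)) '' X.carrier))
    (X.isClosed.inter ((h.isClosed_image hP j).preimage hc)) Set.inter_subset_left
    ⟨y, hy, x, hx, hxy⟩ ?_ hz).2
  rintro n w ⟨hw, w', hw', e⟩
  refine ⟨X.mapsTo n hw, shift n w', X.mapsTo n hw', ?_⟩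
  dsimp only at e ⊢
  rw [h.map_shift, h.map_shift, ← shift_add, ← shift_add, add_comm, shift_add, e, ← shift_add,
    add_comm]

/-- The translates by `0, …, P - 1` of the image of an infinite minimal subshift under a block
substitution of length `P` are pairwise disjoint. -/
theorem phase_unique (h : IsBlockSubst P ψ) (hX : IsMinimalSubshift X)
    (hinf : X.carrier.Infinite) (hm : Set.MapsTo ψ X.carrier X.carrier)
    {j j' : ℤ} (hj : j ∈ Finset.Ico (0 : ℤ) P) (hj' : j' ∈ Finset.Ico (0 : ℤ) P)
    {x y : ℤ → A} (hx : x ∈ X.carrier) (hy : y ∈ X.carrier)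
    (hxy : shift j (ψ x) = shift j' (ψ y)) : j = j' := by
  by_contra hne
  have hP : 0 < P := by have := Finset.mem_Ico.1 hj; lia
  -- Phase j' is redundant: its translate coincides with that of phase j.
  set I := (Finset.Ico (0 : ℤ) P).erase j' with hI
  have hIc : I.card = P - 1 := by rw [hI, Finset.card_erase_of_mem hj']; simp
  have hcov : ∀ x ∈ X.carrier, ∃ j ∈ I, ∃ y ∈ X.carrier, shift j (ψ y) = x := by
    intro w hw
    obtain ⟨i, hi, z, hz, rfl⟩ := h.exists_eq_shift hP hX hm hw
    by_cases hij : i = j'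
    · obtain ⟨z', hz', e⟩ := h.exists_of_shift_eq hP hX hx hy hxy hz
      exact ⟨j, Finset.mem_erase.2 ⟨hne, hj⟩, z', hz', by rw [e, hij]⟩
    · exact ⟨i, Finset.mem_erase.2 ⟨hij, hi⟩, z, hz, rfl⟩
  have : Fintype A := Fintype.ofFinite A
  classical
  -- k is chosen so that P^k exceeds the number of pairs (offset in J, local rule), at most (P -
  -- 1)^k times a constant.
  obtain ⟨k, hk⟩ := exists_mul_pow_lt_pow (Fintype.card (A × A × A → A)) (P - 1)
  rw [Nat.sub_add_cancel hP] at hk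
  obtain ⟨J, hJc, hJ, hJcov⟩ := h.exists_iterate_cover (Finset.erase_subset _ _) hcov k
  rw [hIc] at hJc
  have hb := h.iterate k
  have hPk : 0 < P ^ k := Nat.pow_pos hP
  set Q := P ^ k
  obtain ⟨x₀, hx₀⟩ := hX.1
  have hχ := hm.iterate k hx₀
  choose t ht z _ htz using fun i : Fin Q =>
    hJcov (shift ((i : ℕ) : ℤ) (ψ^[k] x₀)) (X.mapsTo _ hχ)
  have hloc : ∀ i : Fin Q, ∃ f : A × A × A → A,
      ψ^[k] (fun n => f (x₀ (n - 1), x₀ n, x₀ (n + 1))) = ψ^[k] (z i) := by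
    intro i
    have h1 := Finset.mem_Ico.1 (hJ (ht i))
    have h2 := i.2
    refine hb.exists_local_rule (d := (i : ℕ) - t i) (by lia) (by lia) ?_
    rw [sub_eq_add_neg, shift_add, ← htz i, ← shift_add, add_neg_cancel, shift_zero]
  choose f hf using hloc
  have hcard : Fintype.card (J × (A × A × A → A)) < Fintype.card (Fin Q) := by
    rw [Fintype.card_prod, Fintype.card_coe, Fintype.card_fin, mul_comm]
    exact (Nat.mul_le_mul_left _ hJc).trans_lt hk
  obtain ⟨a, b, hab, e⟩ := Fintype.exists_ne_map_eq_of_card_lt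
    (fun i : Fin Q => ((⟨t i, ht i⟩ : J), f i)) hcard
  simp only [Prod.mk.injEq, Subtype.mk.injEq] at e
  have hshift : shift ((a : ℕ) : ℤ) (ψ^[k] x₀) = shift ((b : ℕ) : ℤ) (ψ^[k] x₀) := by
    rw [← htz a, ← htz b, e.1, ← hf a, ← hf b, e.2]
  have hper : ∀ a b : ℤ, a < b → shift a (ψ^[k] x₀) = shift b (ψ^[k] x₀) → False := by
    intro a b hlt e
    refine hinf (hX.finite_of_periodic hχ (q := b - a) (by lia) ?_)
    rw [sub_eq_add_neg, shift_add, ← e, ← shift_add, add_neg_cancel, shift_zero]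
  rcases lt_or_gt_of_ne hab with hlt | hlt
  · exact hper _ _ (by exact_mod_cast hlt) hshift
  · exact hper _ _ (by exact_mod_cast hlt) hshift.symm

/-- A block substitution is injective on an infinite minimal subshift that it preserves. -/
theorem injOn (h : IsBlockSubst P ψ) (hP : 0 < P) (hX : IsMinimalSubshift X)
    (hinf : X.carrier.Infinite) (hm : Set.MapsTo ψ X.carrier X.carrier) :
    Set.InjOn ψ X.carrier := by
  -- The kernels of ψ^n on letters increase with n and stabilize, as the alphabet is finite; from
  -- then on ψ^(n+1) identifies no more than ψ^n.
  let K : ℕ →o Set (A × A) :=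
    ⟨fun n => {p | ψ^[n] (fun _ => p.1) = ψ^[n] (fun _ => p.2)}, monotone_nat_of_le_succ
      fun n p hp => by
        simp only [Set.mem_ofPred_eq, Function.iterate_succ_apply'] at hp ⊢
        rw [hp]⟩
  obtain ⟨n, hn⟩ := WellFoundedGT.monotone_chain_condition K
  have hn1 : ∀ x y : ℤ → A, ψ^[n + 1] x = ψ^[n + 1] y → ψ^[n] x = ψ^[n] y := by
    intro x y hxy
    rw [(h.iterate _).apply_eq_iff (Nat.pow_pos hP)] at hxy ⊢
    intro i
    have : (x i, y i) ∈ K (n + 1) := hxy i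
    rwa [← hn (n + 1) (Nat.le_succ n)] at this
  intro x hx y hy hxy
  have hPn : 0 < P ^ n := Nat.pow_pos hP
  obtain ⟨i, hi, x', hx', rfl⟩ := (h.iterate n).exists_eq_shift hPn hX (hm.iterate n) hx
  obtain ⟨j, hj, y', hy', rfl⟩ := (h.iterate n).exists_eq_shift hPn hX (hm.iterate n) hy
  rw [h.map_shift, h.map_shift, ← Function.iterate_succ_apply' ψ,
    ← Function.iterate_succ_apply' ψ] at hxy
  have hP' : (0 : ℤ) < P := by exact_mod_cast hP
  have hmem : ∀ i ∈ Finset.Ico (0 : ℤ) (P ^ n : ℕ),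
      (P : ℤ) * i ∈ Finset.Ico (0 : ℤ) (P ^ (n + 1) : ℕ) := by
    intro i hi
    rw [Finset.mem_Ico] at hi ⊢
    rw [pow_succ]
    push_cast at hi ⊢
    constructor <;> nlinarith
  -- Once x and y are written as translates of ψ^n x' and ψ^n y', phase uniqueness at level n + 1
  -- forces equal offsets; stability of the kernels then finishes.
  have e := (h.iterate (n + 1)).phase_unique hX hinf (hm.iterate _) (hmem i hi) (hmem j hj)
    hx' hy' hxy
  obtain rfl : i = j := mul_left_cancel₀ hP'.ne' e
  have hxy' := congrArg (shift (-((P : ℤ) * i))) hxy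
  rw [← shift_add, ← shift_add, add_neg_cancel, shift_zero, shift_zero] at hxy'
  rw [hn1 _ _ hxy']

end IsBlockSubst

/-! ### Shift powers and conjugacy -/

/-- The power `σ^n` of the left shift, as a self-map of a subshift. -/
def shiftBy {A : Type*} [TopologicalSpace A] (X : Subshift A ℤ) (n : ℤ) :
    X.carrier → X.carrier :=
  (X.mapsTo n).restrict

theorem coe_shiftBy {A : Type*} [TopologicalSpace A] (X : Subshift A ℤ) (n : ℤ)
    (x : X.carrier) : (shiftBy X n x : ℤ → A) = shift n (x : ℤ → A) := rfl

theorem shiftBy_shiftBy {A : Type*} [TopologicalSpace A] (X : Subshift A ℤ) (m n : ℤ)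
    (x : X.carrier) : shiftBy X m (shiftBy X n x) = shiftBy X (n + m) x :=
  Subtype.ext (shift_add n m _).symm

theorem shiftBy_zero {A : Type*} [TopologicalSpace A] (X : Subshift A ℤ) (x : X.carrier) :
    shiftBy X 0 x = x :=
  Subtype.ext (shift_zero _)

theorem continuous_shiftBy {A : Type*} [TopologicalSpace A] (X : Subshift A ℤ) (n : ℤ) :
    Continuous (shiftBy X n) :=
  (continuous_shift n).restrict (X.mapsTo n)

theorem map_shiftBy_of_map_shiftMap {A B : Type*} [TopologicalSpace A] [TopologicalSpace B]
    {X : Subshift A ℤ} {Y : Subshift B ℤ} {φ : X.carrier → Y.carrier}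
    (h : ∀ x, φ (shiftMap X x) = shiftMap Y (φ x)) (n : ℤ) (x : X.carrier) :
    φ (shiftBy X n x) = shiftBy Y n (φ x) := by
  have h1 : ∀ x, φ (shiftBy X 1 x) = shiftBy Y 1 (φ x) := h
  induction n generalizing x with
  | zero => rw [shiftBy_zero, shiftBy_zero]
  | succ n ih => rw [← shiftBy_shiftBy, h1, ih, shiftBy_shiftBy]
  | pred n ih =>
    have e := h1 (shiftBy X (-n - 1) x)
    rw [shiftBy_shiftBy, sub_add_cancel, ih] at e
    have e' := congrArg (shiftBy Y (-1)) e
    rw [shiftBy_shiftBy, shiftBy_shiftBy, add_neg_cancel, shiftBy_zero] at e'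
    rw [← e', sub_eq_add_neg]

theorem Conjugate.symm {A B : Type*} [TopologicalSpace A] [TopologicalSpace B]
    {X : Subshift A ℤ} {Y : Subshift B ℤ} (h : Conjugate X Y) : Conjugate Y X := by
  obtain ⟨φ, hφ⟩ := h
  refine ⟨φ.symm, fun y => ?_⟩
  rw [φ.symm_apply_eq, hφ, φ.apply_symm_apply]

theorem Conjugate.trans {A B C : Type*} [TopologicalSpace A] [TopologicalSpace B]
    [TopologicalSpace C] {X : Subshift A ℤ} {Y : Subshift B ℤ} {Z : Subshift C ℤ}
    (h : Conjugate X Y) (h' : Conjugate Y Z) : Conjugate X Z := by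
  obtain ⟨φ, hφ⟩ := h
  obtain ⟨χ, hχ⟩ := h'
  exact ⟨φ.trans χ, fun x => by simp only [Homeomorph.trans_apply, hφ, hχ]⟩

/-! ### Minimal subshifts preserved by a substitution -/

section Alphabet

variable {A : Type*} [Finite A] [TopologicalSpace A] [DiscreteTopology A] {Z : Subshift A ℤ}

/-- Points avoiding d form a closed invariant proper subset, empty by minimality; compactness makes
the gap uniform. -/
theorem IsMinimalSubshift.exists_bounded_gap (hZ : IsMinimalSubshift Z) {d : A}
    (hd : ∃ z ∈ Z.carrier, ∃ i, z i = d) :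
    ∃ n : ℕ, ∀ z ∈ Z.carrier, ∃ i : ℤ, -n ≤ i ∧ i ≤ n ∧ z i = d := by
  have hall : ∀ z ∈ Z.carrier, ∃ i, z i = d := by
    by_contra! hcon
    obtain ⟨z, hz, hzd⟩ := hcon
    have hcl : IsClosed {z : ℤ → A | ∀ i, z i ≠ d} := by
      simp only [Set.ofPred_forall]
      exact isClosed_iInter fun i => IsClosed.preimage (f := fun z : ℤ → A => z i)
        (continuous_apply i) (isClosed_discrete {a : A | a ≠ d})
    obtain ⟨y, hy, i, hi⟩ := hd
    refine (hZ.2 (Z.carrier ∩ {z | ∀ i, z i ≠ d}) (Z.isClosed.inter hcl) Set.inter_subset_left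
      ⟨z, hz, hzd⟩ ?_ hy).2 i hi
    rintro n w ⟨hw, hwd⟩
    exact ⟨Z.mapsTo n hw, fun i => hwd _⟩
  refine Z.isClosed.isCompact.elim_directed_cover
    (fun n : ℕ => {z : ℤ → A | ∃ i : ℤ, -n ≤ i ∧ i ≤ n ∧ z i = d}) (fun n => ?_) ?_ ?_
  · refine (isClopen_of_window n _ ?_).2
    rintro x y hxy ⟨i, h1, h2, h3⟩
    exact ⟨i, h1, h2, (hxy i h1 h2).symm.trans h3⟩
  · intro z hz
    obtain ⟨i, hi⟩ := hall z hz
    exact Set.mem_iUnion.2 ⟨i.natAbs, i, by lia, by lia, hi⟩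
  · refine directed_of_isDirected_le fun m n hmn z => ?_
    rintro ⟨i, h1, h2, h3⟩
    exact ⟨i, by lia, by lia, h3⟩

variable {R : ℕ} [NeZero R] {ξ : A → Fin R → A}

/-- A substitution preserving a minimal subshift in which all letters occur is primitive. -/
theorem IsMinimalSubshift.isPrimitive (hZ : IsMinimalSubshift Z) (hR : 2 ≤ R)
    (hocc : ∀ d : A, ∃ z ∈ Z.carrier, z 0 = d)
    (hm : Set.MapsTo (substMap ξ) Z.carrier Z.carrier) : IsPrimitive ξ := by
  have : Fintype A := Fintype.ofFinite A
  choose n hn using fun d : A => hZ.exists_bounded_gap (d := d)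
    ((hocc d).imp fun z hz => ⟨hz.1, 0, hz.2⟩)
  let N := Finset.univ.sup n
  -- This exponent makes the block ξ^(2N+1)(a) longer than 2N + 1, so it contains the interval [0,
  -- 2N] around position N, where b must occur.
  refine ⟨2 * N + 1, fun a b => (mem_iterWord_iff ξ _ a b).2 ?_⟩
  obtain ⟨z, hz, rfl⟩ := hocc a
  have hnb : n b ≤ N := Finset.le_sup (Finset.mem_univ b)
  have hlt : 2 * N + 1 < R ^ (2 * N + 1) := Nat.lt_pow_self (by lia)
  obtain ⟨i, h1, h2, h3⟩ := hn b _ (Z.mapsTo N (hm.iterate (2 * N + 1) hz))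
  refine ⟨N + i, by lia, by lia, ?_⟩
  rw [← h3, shift_apply]
  exact ((isBlockSubst_substMap ξ).iterate (2 * N + 1)).eq_of_zero (fun _ => z 0) z rfl (N + i)
    (by lia) (by lia)

theorem IsMinimalSubshift.substSystem_carrier_eq (hZ : IsMinimalSubshift Z) (hR : 2 ≤ R)
    (hocc : ∀ d : A, ∃ z ∈ Z.carrier, z 0 = d)
    (hm : Set.MapsTo (substMap ξ) Z.carrier Z.carrier) :
    (substSystem ξ).carrier = Z.carrier := by
  have hsub : (substSystem ξ).carrier ⊆ Z.carrier := by
    refine substSystem_subset ξ Z fun i a _ => (wordAppears_iterWord_iff ξ i a _).2 ?_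
    obtain ⟨z, hz, rfl⟩ := hocc a
    refine ⟨_, hm.iterate i hz, 0, fun j h0 hj => ?_⟩
    rw [zero_add]
    exact ((isBlockSubst_substMap ξ).iterate i).eq_of_zero _ (fun _ => z 0) rfl j h0 hj
  refine hsub.antisymm (hZ.2 _ (substSystem ξ).isClosed hsub ?_
    fun n x hx => (substSystem ξ).mapsTo n hx)
  obtain ⟨z, -⟩ := hZ.1
  have : Nonempty A := ⟨z 0⟩
  exact (isMinimalSubshift_substSystem hR (hZ.isPrimitive hR hocc hm)).1

end Alphabet

/-! ### From a map g with gσ = σ^R g to a substitution of length R -/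

section Coding

variable {B : Type*} [Finite B] [TopologicalSpace B] [DiscreteTopology B] {Y : Subshift B ℤ}

/-- A finite-valued observable on a minimal subshift that separates orbits, and whose values along
the first `R` iterates of `g y` are determined by its value at `y`, represents the subshift as a
substitution system. -/
theorem exists_substSystem_of_observable (hY : IsMinimalSubshift Y) {R : ℕ} (hR : 2 ≤ R)
    {g : Y.carrier → Y.carrier}
    (hg : ∀ (n : ℤ) (y : Y.carrier), g (shiftBy Y n y) = shiftBy Y (R * n) (g y))
    {A : Type*} [Finite A] [TopologicalSpace A] [DiscreteTopology A] {w : Y.carrier → A}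
    (hw : Continuous w) (hsurj : Function.Surjective w)
    (hdet : ∀ y y' : Y.carrier, w y = w y' → ∀ j : ℤ, 0 ≤ j → j < R →
      w (shiftBy Y j (g y)) = w (shiftBy Y j (g y')))
    (hsep : ∀ y y' : Y.carrier, (∀ i, w (shiftBy Y i y) = w (shiftBy Y i y')) → y = y') :
    ∃ ξ : A → Fin R → A, IsPrimitive ξ ∧ Conjugate (substSystem ξ) Y := by
  have : NeZero R := ⟨by lia⟩
  have : CompactSpace Y.carrier := isCompact_iff_compactSpace.1 Y.isClosed.isCompact
  -- The choice of a preimage of d is immaterial by `hdet`; this yields `hcg`, that ξ acts on codes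
  -- as g acts on Y.
  let ξ : A → Fin R → A := fun d j => w (shiftBy Y ((j : ℕ) : ℤ) (g (Function.surjInv hsurj d)))
  let code : Y.carrier → ℤ → A := fun y i => w (shiftBy Y i y)
  have hcode : Continuous code := continuous_pi fun i => hw.comp (continuous_shiftBy Y i)
  have hshift : ∀ n y, code (shiftBy Y n y) = shift n (code y) := by
    intro n y
    funext i
    simp only [code, shift_apply, shiftBy_shiftBy]
  have hcg : ∀ y, substMap ξ (code y) = code (g y) := by
    intro y
    funext n
    have hR0 : (0 : ℤ) < R := by lia
    have r0 := Int.emod_nonneg n hR0.ne'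
    have r1 := Int.emod_lt_of_pos n hR0
    have hn := Int.mul_ediv_add_emod n R
    set i := n / R
    generalize n % R = r at r0 r1 hn
    lift r to ℕ using r0
    rw [← hn, substMap_mul_add ξ (code y) i ⟨r, by exact_mod_cast r1⟩]
    simp only [code, ← shiftBy_shiftBy, ← hg, ξ]
    exact hdet _ _ (Function.surjInv_eq hsurj _) _ (by lia) r1
  let Z : Subshift A ℤ := ⟨Set.range code, (isCompact_range hcode).isClosed, by
    rintro n _ ⟨y, rfl⟩
    exact ⟨shiftBy Y n y, hshift n y⟩⟩
  have hZ : IsMinimalSubshift Z := by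
    obtain ⟨y₀, hy₀⟩ := hY.1
    refine ⟨⟨_, ⟨y₀, hy₀⟩, rfl⟩, fun C hC hCZ hne hinv => ?_⟩
    have hsub := hY.2 (Subtype.val '' (code ⁻¹' C))
      ((hC.preimage hcode).isCompact.image continuous_subtype_val).isClosed ?_ ?_ ?_
    · rintro _ ⟨y, rfl⟩
      obtain ⟨y', hy', e⟩ := hsub y.2
      rwa [← Subtype.ext e]
    · rintro _ ⟨y, -, rfl⟩
      exact y.2
    · obtain ⟨c, hc⟩ := hne
      obtain ⟨y, rfl⟩ := hCZ hc
      exact ⟨y, y, hc, rfl⟩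
    · rintro n _ ⟨y, hy, rfl⟩
      refine ⟨shiftBy Y n y, ?_, rfl⟩
      rw [Set.mem_preimage, hshift]
      exact hinv n _ hy
  have hocc : ∀ d : A, ∃ z ∈ Z.carrier, z 0 = d := by
    intro d
    obtain ⟨y, rfl⟩ := hsurj d
    exact ⟨code y, ⟨y, rfl⟩, by simp only [code, shiftBy_zero]⟩
  have hm : Set.MapsTo (substMap ξ) Z.carrier Z.carrier := by
    rintro _ ⟨y, rfl⟩
    exact ⟨g y, (hcg y).symm⟩
  have hcar := hZ.substSystem_carrier_eq hR hocc hm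
  refine ⟨ξ, hZ.isPrimitive hR hocc hm, Conjugate.symm ?_⟩
  let f : Y.carrier → (substSystem ξ).carrier := fun y => ⟨code y, hcar.symm ▸ ⟨y, rfl⟩⟩
  have hf : Continuous f := hcode.subtype_mk _
  have hbij : Function.Bijective f := by
    refine ⟨fun y y' e => hsep y y' fun i => congrFun (congrArg Subtype.val e) i, fun z => ?_⟩
    obtain ⟨y, hy⟩ : z.1 ∈ Z.carrier := hcar ▸ z.2
    exact ⟨y, Subtype.ext hy⟩
  refine ⟨Continuous.homeoOfEquivCompactToT2 (f := Equiv.ofBijective f hbij) hf, fun y => ?_⟩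
  exact Subtype.ext (hshift 1 y)

/-- The first `R` coordinates of a continuous self-map are determined by a finite window. -/
theorem exists_radius {g : Y.carrier → Y.carrier} (hg : Continuous g) (R : ℕ) :
    ∃ s : ℕ, ∀ x y : Y.carrier, (∀ i : ℤ, -s ≤ i → i ≤ s → (x : ℤ → B) i = (y : ℤ → B) i) →
      ∀ j : ℤ, 0 ≤ j → j < R → (g x : ℤ → B) j = (g y : ℤ → B) j := by
  have : CompactSpace Y.carrier := isCompact_iff_compactSpace.1 Y.isClosed.isCompact
  have hco : ∀ i : ℤ, Continuous fun x : Y.carrier => (x : ℤ → B) i :=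
    fun i => (continuous_apply i).comp continuous_subtype_val
  let F : Y.carrier → Fin R → B := fun x j => (g x : ℤ → B) (j : ℕ)
  have hF : Continuous F := continuous_pi fun j => (hco _).comp hg
  -- Were no radius to suffice, these nested compact sets would be nonempty, and a common point
  -- would be a pair of equal points with different F.
  let K : ℕ → Set (Y.carrier × Y.carrier) := fun n =>
    {p | F p.1 ≠ F p.2} ∩
      {p | ∀ i : ℤ, -n ≤ i → i ≤ n → (p.1 : ℤ → B) i = (p.2 : ℤ → B) i}
  have hK : ∀ n, IsClosed (K n) := by
    intro n
    refine IsClosed.inter ?_ ?_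
    · exact (isClosed_discrete {q : (Fin R → B) × (Fin R → B) | q.1 ≠ q.2}).preimage
        ((hF.comp continuous_fst).prodMk (hF.comp continuous_snd))
    · simp only [Set.ofPred_forall]
      exact isClosed_iInter fun i => isClosed_iInter fun _ => isClosed_iInter fun _ =>
        isClosed_eq ((hco i).comp continuous_fst) ((hco i).comp continuous_snd)
  by_contra! hcon
  obtain ⟨p, hp⟩ := IsCompact.nonempty_iInter_of_sequence_nonempty_isCompact_isClosed K
    (fun n p hp => ⟨hp.1, fun i h1 h2 => hp.2 i (by push_cast; lia) (by push_cast; lia)⟩)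
    (fun n => by
      obtain ⟨x, y, hxy, j, h0, hj, hne⟩ := hcon n
      refine ⟨(x, y), fun e => hne ?_, hxy⟩
      lift j to ℕ using h0
      exact congrFun e ⟨j, by exact_mod_cast hj⟩)
    (hK 0).isCompact hK
  rw [Set.mem_iInter] at hp
  refine (hp 0).1 (congrArg F (Subtype.ext (funext fun i => ?_)))
  exact (hp i.natAbs).2 i (by lia) (by lia)

/-- A minimal subshift with a continuous self-map `g` satisfying `g ∘ σ = σ^R ∘ g` is conjugate to
the system of a primitive substitution of length `R`. -/
theorem exists_substSystem_of_map (hY : IsMinimalSubshift Y) {R : ℕ} (hR : 2 ≤ R)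
    {g : Y.carrier → Y.carrier} (hgc : Continuous g)
    (hg : ∀ (n : ℤ) (y : Y.carrier), g (shiftBy Y n y) = shiftBy Y (R * n) (g y)) :
    ∃ (k : ℕ) (ξ : Fin k → Fin R → Fin k), IsPrimitive ξ ∧ Conjugate (substSystem ξ) Y := by
  obtain ⟨s, hs⟩ := exists_radius hgc R
  -- Radius 2s is preserved by the coding: coordinates of g y in [-2s, R - 1 + 2s] lie in blocks m
  -- with |m| ≤ s, because R ≥ 2, and block m depends on y over [m - s, m + s] ⊆ [-2s, 2s].
  let v : Y.carrier → (Set.Icc (-(2 * s) : ℤ) (2 * s) → B) := fun y i => (y : ℤ → B) i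
  have hv : Continuous v :=
    continuous_pi fun i => (continuous_apply _).comp continuous_subtype_val
  let e := Finite.equivFin (Set.range v)
  let w : Y.carrier → Fin (Nat.card (Set.range v)) := fun y => e (Set.rangeFactorization v y)
  have hw : ∀ y y', w y = w y' ↔
      ∀ i : ℤ, -(2 * s) ≤ i → i ≤ 2 * s → (y : ℤ → B) i = (y' : ℤ → B) i := by
    intro y y'
    rw [e.apply_eq_iff_eq, Subtype.ext_iff]
    exact ⟨fun h i h1 h2 => congrFun h ⟨i, h1, h2⟩, fun h => funext fun i => h i i.2.1 i.2.2⟩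
  have hR0 : (0 : ℤ) < R := by lia
  refine ⟨_, exists_substSystem_of_observable hY hR hg (w := w)
    (continuous_of_discreteTopology.comp (hv.subtype_mk _))
    (e.surjective.comp Set.rangeFactorization_surjective) ?_ ?_⟩
  · intro y y' hyy j j0 j1
    rw [hw] at hyy ⊢
    intro i h1 h2
    simp only [coe_shiftBy, shift_apply]
    have r0 := Int.emod_nonneg (j + i) hR0.ne'
    have r1 := Int.emod_lt_of_pos (j + i) hR0
    have hn := Int.mul_ediv_add_emod (j + i) R
    set m := (j + i) / R
    set r := (j + i) % R
    have hR2 : (2 : ℤ) ≤ R := by exact_mod_cast hR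
    have m0 : -(s : ℤ) ≤ m := by by_contra! hlt; nlinarith
    have m1 : m ≤ s := by by_contra! hlt; nlinarith
    have key := hs (shiftBy Y m y) (shiftBy Y m y') (fun i h1 h2 => by
      simp only [coe_shiftBy, shift_apply]
      exact hyy _ (by lia) (by lia)) r r0 r1
    rw [hg, hg] at key
    simpa only [coe_shiftBy, shift_apply, hn] using key
  · intro y y' h
    refine Subtype.ext (funext fun i => ?_)
    have := (hw _ _).1 (h i) 0 (by lia) (by lia)
    simpa only [coe_shiftBy, shift_apply, add_zero] using this

end Coding

/-! ### Dividing the substitution of length R * N by the one of length N -/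

/-- If a minimal system maps into a substitution system of length `N` by a map intertwining `σ`
with `σ^(R * N)`, then some translate of this map takes values in the image of the
substitution. -/
theorem exists_shift_lift {A B : Type*} [TopologicalSpace A] [Finite B] [TopologicalSpace B]
    [DiscreteTopology B] {X : Subshift A ℤ} (hX : IsMinimalSubshift X) [CompactSpace X.carrier]
    [T2Space A] {Y : Subshift B ℤ} (hY : IsMinimalSubshift Y) {N : ℕ} {ψ : (ℤ → B) → ℤ → B}
    (hψ : IsBlockSubst N ψ) (hN : 0 < N) (hm : Set.MapsTo ψ Y.carrier Y.carrier)
    {R : ℕ} {f : X.carrier → Y.carrier} (hf : Continuous f)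
    (hfs : ∀ (n : ℤ) (x : X.carrier), f (shiftBy X n x) = shiftBy Y ((R * N : ℕ) * n) (f x)) :
    ∃ j : ℤ, ∀ x, ∃ y ∈ Y.carrier, shift j (ψ y) = f x := by
  obtain ⟨x₀, hx₀⟩ := hX.1
  obtain ⟨j, -, y₀, hy₀, e₀⟩ := hψ.exists_eq_shift hN hY hm (f ⟨x₀, hx₀⟩).2
  refine ⟨j, fun x => ?_⟩
  -- This set is also σ-invariant: f turns σ into σ^(RN), a power of σ^N, and σ^N preserves σ^j
  -- ψ(Y). Minimality of X then gives every x.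
  have hcl : IsClosed {x : X.carrier | (f x : ℤ → B) ∈ (fun y => shift j (ψ y)) '' Y.carrier} :=
    (hψ.isClosed_image hN j).preimage (continuous_subtype_val.comp hf)
  obtain ⟨x', hx', e⟩ := hX.2 (Subtype.val '' _)
    (hcl.isCompact.image continuous_subtype_val).isClosed (by rintro _ ⟨x, -, rfl⟩; exact x.2)
    ⟨x₀, ⟨x₀, hx₀⟩, ⟨y₀, hy₀, e₀⟩, rfl⟩ (by
      rintro n _ ⟨x, ⟨y, hy, hyx⟩, rfl⟩
      refine ⟨shiftBy X n x, ⟨shift (R * n) y, Y.mapsTo _ hy, ?_⟩, rfl⟩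
      dsimp only at hyx ⊢
      rw [hfs, coe_shiftBy, ← hyx, hψ.map_shift, ← shift_add, ← shift_add]
      congr 1
      push_cast
      ring) x.2
  rwa [← Subtype.ext e]

/-- If a substitution system of length `R * N` is conjugate to one of length `N`, then the latter
is conjugate to a substitution system of length `R`. -/
theorem exists_substSystem_of_conjugate {A B : Type*}
    [Finite A] [TopologicalSpace A] [DiscreteTopology A]
    [Finite B] [TopologicalSpace B] [DiscreteTopology B]
    {M N R : ℕ} (hM : 2 ≤ M) (hN : 2 ≤ N) (θ : A → Fin M → A) (ζ : B → Fin N → B)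
    (hθ : IsPrimitive θ) (hζ : IsPrimitive ζ) (hθne : (substSystem θ).carrier.Nonempty)
    (hζinf : (substSystem ζ).carrier.Infinite)
    (hconj : Conjugate (substSystem θ) (substSystem ζ)) (hMN : M = R * N) (hR : 2 ≤ R) :
    ∃ (k : ℕ) (ξ : Fin k → Fin R → Fin k),
      IsPrimitive ξ ∧ Conjugate (substSystem ξ) (substSystem ζ) := by
  have : NeZero M := ⟨by lia⟩
  have : NeZero N := ⟨by lia⟩
  have : Nonempty A := hθne.elim fun x _ => ⟨x 0⟩
  have : Nonempty B := hζinf.nonempty.elim fun x _ => ⟨x 0⟩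
  have hX := isMinimalSubshift_substSystem hM hθ
  have hY := isMinimalSubshift_substSystem hN hζ
  have hmX := mapsTo_substMap hM hθ
  have hmY := mapsTo_substMap hN hζ
  have hbX := isBlockSubst_substMap θ
  have hbY := isBlockSubst_substMap ζ
  have hinj := hbY.injOn (by lia) hY hζinf hmY
  set X := substSystem θ
  set Y := substSystem ζ
  have : CompactSpace X.carrier := isCompact_iff_compactSpace.1 X.isClosed.isCompact
  have : CompactSpace Y.carrier := isCompact_iff_compactSpace.1 Y.isClosed.isCompact
  obtain ⟨φ, hφ⟩ := hconj
  have hφs := map_shiftBy_of_map_shiftMap hφ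
  let f : X.carrier → Y.carrier := fun x => φ (hmX.restrict (substMap θ) _ _ x)
  have hf : Continuous f := φ.continuous.comp ((hbX.continuous (by lia)).restrict hmX)
  have hfs : ∀ (n : ℤ) (x : X.carrier),
      f (shiftBy X n x) = shiftBy Y ((R * N : ℕ) * n) (f x) := by
    intro n x
    rw [← hφs, ← hMN]
    exact congrArg φ (Subtype.ext (hbX.map_shift n x))
  obtain ⟨j, hj⟩ := exists_shift_lift hX hY hbY (by lia) hmY hf hfs
  let S : Y.carrier → Y.carrier := fun y => shiftBy Y j (hmY.restrict (substMap ζ) _ _ y)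
  have hS : Continuous S :=
    (continuous_shiftBy Y j).comp ((hbY.continuous (by lia)).restrict hmY)
  have hSs : ∀ (n : ℤ) (y : Y.carrier), S (shiftBy Y n y) = shiftBy Y (N * n) (S y) := by
    intro n y
    rw [shiftBy_shiftBy, add_comm, ← shiftBy_shiftBy]
    exact congrArg (shiftBy Y j) (Subtype.ext (hbY.map_shift n y))
  have hSinj : Function.Injective S := by
    intro y y' e
    have e' := congrArg (shiftBy Y (-j)) e
    rw [shiftBy_shiftBy, shiftBy_shiftBy, add_neg_cancel, shiftBy_zero, shiftBy_zero] at e'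
    exact Subtype.ext (hinj y.2 y'.2 (congrArg Subtype.val e'))
  -- g = S⁻¹ f φ⁻¹. It is continuous because the injective S is a closed embedding of a compact
  -- space, and its relation with σ follows by cancelling S.
  choose g hg using fun y : Y.carrier =>
    show ∃ y', S y' = f (φ.symm y) from
      (hj (φ.symm y)).elim fun y' h => ⟨⟨y', h.1⟩, Subtype.ext h.2⟩
  refine exists_substSystem_of_map hY hR (g := g) ?_ fun n y => hSinj ?_
  · rw [(hS.isClosedEmbedding hSinj).isInducing.continuous_iff, show S ∘ g = f ∘ φ.symm from
      funext hg]
    exact hf.comp φ.symm.continuous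
  · have hsymm : φ.symm (shiftBy Y n y) = shiftBy X n (φ.symm y) := by
      rw [φ.symm_apply_eq, hφs, φ.apply_symm_apply]
    rw [hg, hSs, hg, hsymm, hfs]
    congr 1
    push_cast
    ring

end ConstLength

theorem mainTheorem2 {A B : Type*}
    [Finite A] [TopologicalSpace A] [DiscreteTopology A]
    [Finite B] [TopologicalSpace B] [DiscreteTopology B]
    {M N R : ℕ} (hM : 2 ≤ M) (hN : 2 ≤ N)
    (θ : A → Fin M → A) (ζ : B → Fin N → B)
    (hθ : ConstLength.IsPrimitive θ) (hζ : ConstLength.IsPrimitive ζ)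
    (hθinf : (ConstLength.substSystem θ).carrier.Infinite)
    (hζinf : (ConstLength.substSystem ζ).carrier.Infinite)
    (hconj : ConstLength.Conjugate (ConstLength.substSystem θ) (ConstLength.substSystem ζ))
    (hMN : M = R * N) (hR : 1 < R) :
    ∃ (k : ℕ) (ξ : Fin k → Fin R → Fin k),
      ConstLength.IsPrimitive ξ ∧
      ConstLength.Conjugate (ConstLength.substSystem ξ) (ConstLength.substSystem θ) ∧
      ConstLength.Conjugate (ConstLength.substSystem ξ) (ConstLength.substSystem ζ) := by
  obtain ⟨k, ξ, hξ, hc⟩ := ConstLength.exists_substSystem_of_conjugate hM hN θ ζ hθ hζ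
    hθinf.nonempty hζinf hconj hMN hR
  exact ⟨k, ξ, hξ, hc.trans hconj.symm, hc⟩
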